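/- A tropical signomial on $\mathbb{R}^d$ is a function $g(x)=\max_{a\in A}(c_a+\langle a,x\rangle)$ given by a nonempty finite set $A\subset\mathbb{R}^d$ of exponents and coefficients $c_a\in\mathbb{R}$. Its monomial length $\mathtt{mlen}(g)$ is the number of monomials of $g$ in reduced form, i.e. the number of $a\in A$ such that removing the monomial $c_a+\langle a,x\rangle$ changes the function. For a piecewise linear function $f:\mathbb{R}^d\to\mathbb{R}$, let $\mathcal{V}(f)$ be its locus of non-linearity, i.e. the set of points having no neighbourhood on which $f$ is affine; the linear regions of $f$ are the connected components of $\mathbb{R}^d\setminus\mathcal{V}(f)$, and $r(\mathcal{V}(f))$ is their number. For a tropical signomial $g$, $\mathcal{V}(g)$ is a polyhedral complex whose closed cells are the sets of all $y$ at which every monomial attaining the maximum at $x$ attains the maximum, for $x\in\mathcal{V}(g)$. The cells of $\mathcal{V}(g)\cap\mathcal{V}(h)$ are the nonempty intersections of a cell of $\mathcal{V}(g)$ with a cell of $\mathcal{V}(h)$, and the Euler characteristic of a polyhedral complex $X$ is $\chi(X)=\sum_{P}(-1)^{\dim P}$, the sum over its (bounded and unbounded) nonempty closed cells. Let $d\ge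 0$ and let $\varphi=g\oslash h$ be a tropical rational signomial on $\mathbb{R}^d$, i.e. $\varphi(x)=g(x)-h(x)$ for tropical signomials $g,h$ on $\mathbb{R}^d$. Then $\varphi$ has finitely many linear regions, and \[ r(\mathcal{V}(\varphi))\le \mathtt{mlen}(g)+\mathtt{mlen}(h)+(-1)^{d+2}\,\chi(\mathcal{V}(g)\cap\mathcal{V}(h)). \] -/

import Mathlib

open scoped Matrix Topology

noncomputable section

/-- A tropical (max-plus) signomial `⨁ₐ c(a) ⊙ x^{⊙a}` in `d` variables: a nonempty finite set of
pairwise distinct real exponent vectors, each carrying a real coefficient. The values of `coeff`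
outside `exponents` are never used. -/
structure TropicalSignomial (d : ℕ) where
  exponents : Finset (Fin d → ℝ)
  exponents_nonempty : exponents.Nonempty
  coeff : (Fin d → ℝ) → ℝ

namespace TropicalSignomial

variable {d : ℕ}

/-- The monomial `c(a) ⊙ x^{⊙a}`, that is, the affine function `c(a) + ⟨a, x⟩`. -/
def monomial (g : TropicalSignomial d) (a x : Fin d → ℝ) : ℝ :=
  g.coeff a + a ⬝ᵥ x

/-- The real-valued function of `g`: the maximum of its monomials. -/
def eval (g : TropicalSignomial d) (x : Fin d → ℝ) : ℝ :=
  g.exponents.sup' g.exponents_nonempty fun a => g.monomial a x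

/-- The monomial with exponent `a` is redundant: the remaining monomials (at least one remains)
define the same real-valued function. -/
def Redundant (g : TropicalSignomial d) (a : Fin d → ℝ) : Prop :=
  ∃ hne : (g.exponents.erase a).Nonempty,
    ∀ x, ((g.exponents.erase a).sup' hne fun b => g.monomial b x) = g.eval x

/-- `g` is reduced: removing any one of its monomials changes the real-valued function. -/
def Reduced (g : TropicalSignomial d) : Prop :=
  ∀ a ∈ g.exponents, ¬ g.Redundant a

open Classical in
/-- The monomial length of `g`: the number of its monomials that are not redundant. -/
def mlen (g : TropicalSignomial d) : ℕ :=
  (g.exponents.filter fun a => ¬ g.Redundant a).card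

/-- For a reduced signomial the monomial length is the number of all of its monomials. -/
theorem mlen_of_reduced (g : TropicalSignomial d) (hg : g.Reduced) :
    g.mlen = g.exponents.card := by
  classical
  unfold mlen
  rw [Finset.filter_true_of_mem hg]

open Classical in
/-- The exponents of the monomials of `g` that attain the maximum at `x`. -/
def argmax (g : TropicalSignomial d) (x : Fin d → ℝ) : Finset (Fin d → ℝ) :=
  g.exponents.filter fun a => g.monomial a x = g.eval x

/-- The closed cell having `x` in its relative interior, in the polyhedral subdivision of `ℝᵈ`
induced by `g`. -/
def cell (g : TropicalSignomial d) (x : Fin d → ℝ) : Set (Fin d → ℝ) :=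
  {y | g.argmax x ⊆ g.argmax y}

end TropicalSignomial

/-- The locus of non-linearity `𝒱(f)` of a function `f : ℝᵈ → ℝ`: the points near which `f` does
not agree with any affine function. -/
def nonlinearLocus {d : ℕ} (f : (Fin d → ℝ) → ℝ) : Set (Fin d → ℝ) :=
  {x | ¬ ∃ l : (Fin d → ℝ) →ᵃ[ℝ] ℝ, ∀ᶠ y in 𝓝 x, f y = l y}

/-- The linear regions of `f`: the regions into which `𝒱(f)` divides `ℝᵈ`, that is, the connected
components of the complement of `𝒱(f)`. -/
def linearRegions {d : ℕ} (f : (Fin d → ℝ) → ℝ) : Set (Set (Fin d → ℝ)) :=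
  {U | ∃ x ∈ (nonlinearLocus f)ᶜ, U = connectedComponentIn (nonlinearLocus f)ᶜ x}

/-- The (closed, nonempty) cells of the tropical hypersurface `𝒱(g)` as a polyhedral complex. -/
def TropicalSignomial.hypersurface {d : ℕ} (g : TropicalSignomial d) :
    Set (Set (Fin d → ℝ)) :=
  {P | ∃ x ∈ nonlinearLocus g.eval, P = g.cell x}

/-- The intersection of two polyhedral complexes: its cells are the nonempty intersections of a
cell of the first with a cell of the second. -/
def complexInter {d : ℕ} (X Y : Set (Set (Fin d → ℝ))) : Set (Set (Fin d → ℝ)) :=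
  {R | R.Nonempty ∧ ∃ P ∈ X, ∃ Q ∈ Y, R = P ∩ Q}

/-- The dimension of a cell: the dimension of its affine span. -/
def cellDim {d : ℕ} (P : Set (Fin d → ℝ)) : ℕ :=
  Module.finrank ℝ (vectorSpan ℝ P)

/-- The Euler characteristic of a finite polyhedral complex, given by its nonempty cells: the
alternating sum of the numbers of cells in the different dimensions. -/
def eulerChar {d : ℕ} (X : Set (Set (Fin d → ℝ))) : ℤ :=
  ∑ᶠ P ∈ X, (-1 : ℤ) ^ cellDim P

/-- A tropical hypersurface has finitely many cells. -/
theorem TropicalSignomial.hypersurface_finite {d : ℕ} (g : TropicalSignomial d) :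
    g.hypersurface.Finite := by
  classical
  refine ((g.exponents.powerset.finite_toSet).image
    fun S => {y | S ⊆ g.argmax y}).subset ?_
  rintro P ⟨x, -, rfl⟩
  exact ⟨g.argmax x, Finset.mem_coe.2 (Finset.mem_powerset.2 (Finset.filter_subset _ _)), rfl⟩

/-- Hence the sum that defines the Euler characteristic of an intersection is finite. -/
theorem complexInter_finite {d : ℕ} {X Y : Set (Set (Fin d → ℝ))}
    (hX : X.Finite) (hY : Y.Finite) : (complexInter X Y).Finite := by
  refine ((hX.prod hY).image fun p => p.1 ∩ p.2).subset ?_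
  rintro R ⟨-, P, hP, Q, hQ, rfl⟩
  exact ⟨(P, Q), ⟨hP, hQ⟩, rfl⟩

end

/-!
The Euler characteristic with compact support, whose value on a relatively open convex set `C` is
`(-1) ^ dim C`, extends to a linear functional on all functions `ℝᵈ → ℚ`. The points at which the
same monomials of `g` and the same monomials of `h` attain the maxima form a relatively open convex
set, and these sets are the relatively open cells of the common refinement of the two subdivisions.
Applying the functional to the inclusion-exclusion identity for the indicator functions of `𝒱(g)`
and `𝒱(h)`, and using that the open cells have dimension `d`, one finds that
`ℝᵈ ∖ (𝒱(g) ∪ 𝒱(h))` has exactly `mlen g + mlen h - 1 + (-1) ^ d χ(𝒱(g) ∩ 𝒱(h))` regions. This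
set is dense and contained in `ℝᵈ ∖ 𝒱(φ)`, so every linear region of `φ` contains one of them.
-/

/-- A convex set `C` which is open in its affine span; `W` is the direction of that span, as long as
`C` is nonempty. Openness is expressed without a topology: from each point of `C` one can move a
little exactly in the directions of `W`. -/
structure IsRelOpenConvex {V : Type*} [AddCommGroup V] [Module ℝ V] (C : Set V)
    (W : Submodule ℝ V) : Prop where
  convex : Convex ℝ C
  mem_direction_iff : ∀ x ∈ C, ∀ w, w ∈ W ↔ ∃ ε : ℝ, 0 < ε ∧ x + ε • w ∈ C

namespace IsRelOpenConvex

variable {V V' : Type*} [AddCommGroup V] [Module ℝ V] [AddCommGroup V'] [Module ℝ V']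
  {C D : Set V} {W Z : Submodule ℝ V}

theorem univ : IsRelOpenConvex (Set.univ : Set V) ⊤ :=
  ⟨convex_univ, fun _ _ _ => ⟨fun _ => ⟨1, one_pos, trivial⟩, fun _ => trivial⟩⟩

theorem sub_mem (hC : IsRelOpenConvex C W) {x y : V} (hx : x ∈ C) (hy : y ∈ C) : y - x ∈ W :=
  (hC.mem_direction_iff x hx _).2 ⟨1, one_pos, by simpa using hy⟩

theorem le_vectorSpan (hC : IsRelOpenConvex C W) (hne : C.Nonempty) : W ≤ vectorSpan ℝ C := by
  obtain ⟨x, hx⟩ := hne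
  intro w hw
  obtain ⟨ε, hε, hxw⟩ := (hC.mem_direction_iff x hx w).1 hw
  have hmem := vsub_mem_vectorSpan ℝ hxw hx
  rw [vsub_eq_sub, add_sub_cancel_left] at hmem
  exact (Submodule.smul_mem_iff _ hε.ne').1 hmem

theorem eventually_add_smul_mem (hC : IsRelOpenConvex C W) {x w : V} (hx : x ∈ C) (hw : w ∈ W) :
    ∀ᶠ ε : ℝ in 𝓝[>] 0, x + ε • w ∈ C := by
  obtain ⟨δ, hδ, hxδ⟩ := (hC.mem_direction_iff x hx w).1 hw
  filter_upwards [Ioo_mem_nhdsGT hδ] with ε hε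
  have hmem := hC.convex.add_smul_mem hx hxδ
    (t := ε / δ) ⟨(div_pos hε.1 hδ).le, (div_le_one hδ).2 hε.2.le⟩
  rwa [smul_smul, div_mul_cancel₀ _ hδ.ne'] at hmem

theorem inter (hC : IsRelOpenConvex C W) (hD : IsRelOpenConvex D Z) :
    IsRelOpenConvex (C ∩ D) (W ⊓ Z) := by
  refine ⟨hC.convex.inter hD.convex, fun x hx w => ⟨fun hw => ?_, ?_⟩⟩
  · obtain ⟨ε, hmem, hε⟩ := (((hC.eventually_add_smul_mem hx.1 hw.1).and
      (hD.eventually_add_smul_mem hx.2 hw.2)).and self_mem_nhdsWithin).exists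
    exact ⟨ε, hε, hmem⟩
  · rintro ⟨ε, hε, hεC, hεD⟩
    exact ⟨(hC.mem_direction_iff x hx.1 w).2 ⟨ε, hε, hεC⟩,
      (hD.mem_direction_iff x hx.2 w).2 ⟨ε, hε, hεD⟩⟩

theorem preimage (hC : IsRelOpenConvex C W) (f : V' →ᵃ[ℝ] V) :
    IsRelOpenConvex (f ⁻¹' C) (W.comap f.linear) := by
  refine ⟨hC.convex.affine_preimage f, fun x hx w => ?_⟩
  have hstep (ε : ℝ) : f (x + ε • w) = f x + ε • f.linear w := by
    rw [add_comm x, ← vadd_eq_add, f.map_vadd, map_smul, vadd_eq_add, add_comm]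
  simp only [Submodule.mem_comap, hC.mem_direction_iff _ hx, Set.mem_preimage, hstep]

theorem image (hC : IsRelOpenConvex C W) (f : V →ᵃ[ℝ] V') :
    IsRelOpenConvex (f '' C) (W.map f.linear) := by
  refine ⟨hC.convex.affine_image f, ?_⟩
  rintro - ⟨x, hx, rfl⟩ s
  constructor
  · rintro ⟨w, hw, rfl⟩
    obtain ⟨ε, hε, hxw⟩ := (hC.mem_direction_iff x hx w).1 hw
    refine ⟨ε, hε, _, hxw, ?_⟩
    rw [add_comm x, ← vadd_eq_add, f.map_vadd, map_smul, vadd_eq_add, add_comm]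
  · rintro ⟨ε, hε, z, hz, hzs⟩
    refine ⟨ε⁻¹ • (z - x), W.smul_mem _ (hC.sub_mem hx hz), ?_⟩
    rw [map_smul, ← vsub_eq_sub, f.linearMap_vsub, hzs, vsub_eq_sub, add_sub_cancel_left,
      inv_smul_smul₀ hε.ne']

theorem isOpen_of_direction_eq_top {C : Set ℝ} (hC : IsRelOpenConvex C ⊤) : IsOpen C := by
  refine isOpen_iff_mem_nhds.2 fun x hx => ?_
  obtain ⟨ε, hε, hl⟩ := (hC.mem_direction_iff x hx (-1)).1 trivial
  obtain ⟨δ, hδ, hr⟩ := (hC.mem_direction_iff x hx 1).1 trivial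
  refine Filter.mem_of_superset (Icc_mem_nhds ?_ ?_) (hC.convex.ordConnected.out hl hr) <;>
    simpa

end IsRelOpenConvex

theorem exists_linearMap_eq_of_eventually_eq {α : Type*} (K : Type*) [Field K] (F : Filter α)
    [F.NeBot] : ∃ L : (α → K) →ₗ[K] K, ∀ f c, (∀ᶠ x in F, f x = c) → L f = c := by
  let ofFun : (α → K) →ₗ[K] F.Germ K :=
    { toFun := fun f => f, map_add' := fun _ _ => rfl, map_smul' := fun _ _ => rfl }
  obtain ⟨L, hL⟩ := (LinearMap.toSpanSingleton K (F.Germ K) 1).exists_leftInverse_of_injective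
    (LinearMap.ker_toSpanSingleton K one_ne_zero)
  refine ⟨L ∘ₗ ofFun, fun f c hf => ?_⟩
  have hconst : ofFun f = LinearMap.toSpanSingleton K (F.Germ K) 1 c :=
    Filter.Germ.coe_eq.2 (hf.mono fun x hx => by simp [hx])
  rw [LinearMap.comp_apply, hconst]
  exact LinearMap.congr_fun hL c

theorem exists_linearMap_single_eq (α K : Type*) [DecidableEq α] [Field K] :
    ∃ S : (α → K) →ₗ[K] K, ∀ a c, S (Pi.single a c) = c := by
  obtain ⟨P, hP⟩ := (Finsupp.lcoeFun : (α →₀ K) →ₗ[K] α → K).exists_leftInverse_of_injective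
    (LinearMap.ker_eq_bot.2 DFunLike.coe_injective)
  refine ⟨Finsupp.linearCombination K (fun _ => 1) ∘ₗ P, fun a c => ?_⟩
  have hsingle : P (Pi.single a c) = Finsupp.single a c := by
    rw [← Finsupp.single_eq_pi_single]
    exact LinearMap.congr_fun hP (Finsupp.single a c)
  rw [LinearMap.comp_apply, hsingle, Finsupp.linearCombination_single, smul_eq_mul, mul_one]

theorem exists_linearMap_eq_jump_sub_limit (X K : Type*) [LinearOrder X] [TopologicalSpace X]
    [∀ k : X, (𝓝[>] k).NeBot] [(Filter.atBot : Filter X).NeBot] [Field K] :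
    ∃ E : (X → K) →ₗ[K] K, ∀ (f r : X → K) (k : X) (c l : K),
      (∀ x, ∀ᶠ y in 𝓝[>] x, f y = r x) → f - r = Pi.single k c →
        (∀ᶠ y in Filter.atBot, f y = l) → E f = c - l := by
  obtain ⟨S, hS⟩ := exists_linearMap_single_eq X K
  choose R hR using fun x : X => exists_linearMap_eq_of_eventually_eq K (𝓝[>] x)
  obtain ⟨L, hL⟩ := exists_linearMap_eq_of_eventually_eq K (Filter.atBot : Filter X)
  refine ⟨S ∘ₗ (LinearMap.id - LinearMap.pi R) - L, fun f r k c l hr hjump hl => ?_⟩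
  have hRf : LinearMap.pi R f = r := funext fun x => hR x f _ (hr x)
  change S (f - LinearMap.pi R f) - L f = c - l
  rw [hRf, hjump, hS, hL f l hl]

section OrderTopology

variable {X : Type*} [LinearOrder X] [TopologicalSpace X] [OrderTopology X] {C : Set X} {k : X}

theorem eventually_nhdsGT_mem_of_isGLB (hC : C.OrdConnected) (hk : IsGLB C k) (hne : C.Nonempty)
    (hkC : k ∉ C) : ∀ᶠ y in 𝓝[>] k, y ∈ C := by
  obtain ⟨c, hc⟩ := hne
  have hkc : k < c := (hk.1 hc).lt_of_ne fun h => hkC (h ▸ hc)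
  filter_upwards [Ioo_mem_nhdsGT hkc] with y hy
  obtain ⟨b, hb, -, hby⟩ := hk.exists_between hy.1
  exact hC.out hb hc ⟨hby.le, hy.2.le⟩

theorem eventually_nhdsGT_mem_iff_of_not_isGLB (hopen : IsOpen C) (hC : C.OrdConnected)
    (hk : ¬IsGLB C k) : ∀ᶠ y in 𝓝[>] k, y ∈ C ↔ k ∈ C := by
  by_cases hkC : k ∈ C
  · filter_upwards [nhdsWithin_le_nhds (hopen.mem_nhds hkC)] with y hy
    exact iff_of_true hy hkC
  by_cases hlower : k ∈ lowerBounds C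
  · obtain ⟨b, hb, hkb⟩ : ∃ b ∈ lowerBounds C, k < b := by
      by_contra! h
      exact hk ⟨hlower, h⟩
    filter_upwards [Ioo_mem_nhdsGT hkb] with y hy
    exact iff_of_false (fun hyC => (hb hyC).not_gt hy.2) hkC
  · obtain ⟨c, hc, hck⟩ : ∃ c ∈ C, c < k := by simpa [lowerBounds] using hlower
    filter_upwards [self_mem_nhdsWithin] with y hy
    exact iff_of_false (fun hyC => hkC (hC.out hc hyC ⟨hck.le, le_of_lt hy⟩)) hkC

theorem notMem_of_isOpen_of_isGLB [DenselyOrdered X] [NoMinOrder X] (hopen : IsOpen C)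
    (hk : IsGLB C k) : k ∉ C := by
  intro hkC
  obtain ⟨y, hy, hyk⟩ := Filter.nonempty_of_mem (Filter.inter_mem
    (mem_nhdsWithin_of_mem_nhds (hopen.mem_nhds hkC)) (self_mem_nhdsWithin (s := Set.Iio k)))
  exact (hk.1 hy).not_gt hyk

theorem eventually_nhdsGT_ne (k p : X) : ∀ᶠ y in 𝓝[>] k, y ≠ p := by
  rcases eq_or_ne k p with rfl | hkp
  · filter_upwards [self_mem_nhdsWithin] with y hy
    exact ne_of_gt hy
  · exact nhdsWithin_le_nhds (eventually_ne_nhds hkp)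

theorem eventually_nhdsGT_indicator_one_eq {K : Type*} [Zero K] [One K] (hopen : IsOpen C)
    (hC : C.OrdConnected) (hk : ¬IsGLB C k) :
    ∀ᶠ y in 𝓝[>] k, C.indicator (1 : X → K) y = C.indicator 1 k := by
  classical
  filter_upwards [eventually_nhdsGT_mem_iff_of_not_isGLB hopen hC hk] with y hy
  simp only [Set.indicator_apply, hy, Pi.one_apply]

theorem eventually_nhdsGT_indicator_one_eq_update {K : Type*} [Zero K] [One K] {a : X}
    (hopen : IsOpen C) (hC : C.OrdConnected) (hne : C.Nonempty) (ha : IsGLB C a) (haC : a ∉ C)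
    (k : X) :
    ∀ᶠ y in 𝓝[>] k, C.indicator (1 : X → K) y = Function.update (C.indicator 1) a 1 k := by
  rcases eq_or_ne k a with rfl | hka
  · rw [Function.update_self]
    exact (eventually_nhdsGT_mem_of_isGLB hC ha hne haC).mono fun y hy => Set.indicator_of_mem hy 1
  · rw [Function.update_of_ne hka]
    exact eventually_nhdsGT_indicator_one_eq hopen hC fun hk => hka (hk.unique ha)

end OrderTopology

theorem finrank_map_fst_add_finrank_comap_inr {K V V' : Type*} [DivisionRing K] [AddCommGroup V]
    [Module K V] [AddCommGroup V'] [Module K V'] (W : Submodule K (V × V'))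
    [FiniteDimensional K W] :
    Module.finrank K (W.map (LinearMap.fst K V V')) +
      Module.finrank K (W.comap (LinearMap.inr K V V')) = Module.finrank K W := by
  rw [← LinearMap.finrank_range_add_finrank_ker ((LinearMap.fst K V V').domRestrict W),
    LinearMap.range_domRestrict]
  congr 1
  have hker : (LinearMap.ker ((LinearMap.fst K V V').domRestrict W)).map W.subtype =
      (W.comap (LinearMap.inr K V V')).map (LinearMap.inr K V V') := by
    rw [Submodule.map_comap_eq, LinearMap.range_inr]
    ext v
    simp [and_comm]
  rw [← Submodule.finrank_map_subtype_eq, hker]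
  exact (Submodule.equivMapOfInjective _ LinearMap.inr_injective _).finrank_eq

/-- A linear functional on rational-valued functions which takes the Euler characteristic with
compact support of each nonempty relatively open convex set on its indicator function. It extends
the Euler characteristic to a linear functional on all functions, so that it may be applied to
identities between indicator functions. -/
def IsEulerFunctional {V : Type*} [AddCommGroup V] [Module ℝ V] (E : (V → ℚ) →ₗ[ℚ] ℚ) : Prop :=
  ∀ (C : Set V) (W : Submodule ℝ V), IsRelOpenConvex C W → C.Nonempty →
    E (C.indicator 1) = (-1) ^ Module.finrank ℝ W

theorem isEulerFunctional_of_singleton_of_isOpen {E : (ℝ → ℚ) →ₗ[ℚ] ℚ}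
    (hpoint : ∀ p, E (({p} : Set ℝ).indicator 1) = 1)
    (hopen : ∀ C : Set ℝ, IsOpen C → C.OrdConnected → C.Nonempty → E (C.indicator 1) = -1) :
    IsEulerFunctional E := by
  intro C W hC hne
  rcases eq_bot_or_eq_top W with rfl | rfl
  · obtain ⟨p, hp⟩ := hne
    have hCp : C = {p} := Set.eq_singleton_iff_unique_mem.2
      ⟨hp, fun y hy => sub_eq_zero.1 ((Submodule.mem_bot ℝ).1 (hC.sub_mem hp hy))⟩
    rw [hCp, hpoint, finrank_bot, pow_zero]
  · rw [hopen C hC.isOpen_of_direction_eq_top hC.convex.ordConnected hne, finrank_top,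
      Module.finrank_self, pow_one]

/- The functional is `f ↦ ∑ₖ (f k - f (k+)) - f (-∞)`. A point contributes only through its own
jump; a nonempty open interval only through the jump at its lower end, or through its value at `-∞`
if it is unbounded below. -/
theorem exists_isEulerFunctional_real : ∃ E : (ℝ → ℚ) →ₗ[ℚ] ℚ, IsEulerFunctional E := by
  obtain ⟨E, hE⟩ := exists_linearMap_eq_jump_sub_limit ℝ ℚ
  refine ⟨E, isEulerFunctional_of_singleton_of_isOpen (fun p => ?_) fun C hopen hC hne => ?_⟩
  · rw [hE _ 0 p 1 0 (fun k => (eventually_nhdsGT_ne k p).mono fun y hy =>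
      Set.indicator_of_notMem (s := {p}) hy 1), sub_zero]
    · ext k
      simp [Set.indicator_apply, Pi.single_apply]
    · filter_upwards [Filter.eventually_lt_atBot p] with y hy
      exact Set.indicator_of_notMem hy.ne 1
  by_cases hbdd : BddBelow C
  · obtain ⟨a, ha⟩ : ∃ a, IsGLB C a := ⟨_, isGLB_csInf hne hbdd⟩
    have haC : a ∉ C := notMem_of_isOpen_of_isGLB hopen ha
    rw [hE _ (Function.update (C.indicator 1) a 1) a (-1) 0
      (eventually_nhdsGT_indicator_one_eq_update hopen hC hne ha haC), sub_zero]
    · ext k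
      rcases eq_or_ne k a with rfl | hka
      · simp [haC]
      · simp [hka]
    · filter_upwards [Filter.eventually_lt_atBot a] with y hy
      exact Set.indicator_of_notMem (fun hyC => (ha.1 hyC).not_gt hy) 1
  · rw [hE _ (C.indicator 1) 0 0 1 fun k =>
      eventually_nhdsGT_indicator_one_eq hopen hC fun hk => hbdd ⟨k, hk.1⟩, zero_sub]
    · rw [sub_self, Pi.single_zero]
    · obtain ⟨c, hc⟩ := hne
      filter_upwards [Filter.eventually_lt_atBot c] with y hy
      obtain ⟨b, hb, hby⟩ := not_bddBelow_iff.1 hbdd y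
      exact Set.indicator_of_mem (hC.out hb hc ⟨hby.le, hy.le⟩) 1

namespace IsEulerFunctional

variable {V V' : Type*} [AddCommGroup V] [Module ℝ V] [AddCommGroup V'] [Module ℝ V']

theorem comp_funLeft_equiv {E : (V → ℚ) →ₗ[ℚ] ℚ} (hE : IsEulerFunctional E) (e : V ≃ₗ[ℝ] V') :
    IsEulerFunctional (E ∘ₗ LinearMap.funLeft ℚ ℚ e) := by
  rintro C W hC ⟨x, hx⟩
  have hpre := hC.preimage e.toLinearMap.toAffineMap
  exact (hE _ _ hpre ⟨e.symm x, by simpa using hx⟩).trans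
    (congrArg _ (e.ofSubmodule' W).finrank_eq)

/- Fubini: integrate first over the slices of `C`, which all have the same direction, then over the
projection of `C`. -/
theorem prod [FiniteDimensional ℝ V] [FiniteDimensional ℝ V'] {E : (V → ℚ) →ₗ[ℚ] ℚ}
    {E' : (V' → ℚ) →ₗ[ℚ] ℚ} (hE : IsEulerFunctional E) (hE' : IsEulerFunctional E') :
    IsEulerFunctional
      (E ∘ₗ LinearMap.pi fun x => E' ∘ₗ LinearMap.funLeft ℚ ℚ (Prod.mk x : V' → V × V')) := by
  intro C W hC hne
  have hproj : IsRelOpenConvex (Prod.fst '' C) (W.map (LinearMap.fst ℝ V V')) :=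
    hC.image (LinearMap.fst ℝ V V').toAffineMap
  have hslice (x : V) :
      IsRelOpenConvex (Prod.mk x ⁻¹' C) (W.comap (LinearMap.inr ℝ V V')) :=
    hC.preimage ((AffineMap.const ℝ V' x).prod (AffineMap.id ℝ V'))
  have hinner : (fun x => E' ((Prod.mk x ⁻¹' C).indicator 1)) =
      (-1 : ℚ) ^ Module.finrank ℝ (W.comap (LinearMap.inr ℝ V V')) •
        (Prod.fst '' C).indicator 1 := by
    funext x
    by_cases hx : x ∈ Prod.fst '' C
    · obtain ⟨⟨x, y⟩, hxy, rfl⟩ := hx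
      rw [hE' _ _ (hslice x) ⟨y, hxy⟩, Pi.smul_apply,
        Set.indicator_of_mem (Set.mem_image_of_mem _ hxy), Pi.one_apply, smul_eq_mul, mul_one]
    · have hempty : Prod.mk x ⁻¹' C = ∅ :=
        Set.eq_empty_of_forall_notMem fun y hy => hx ⟨_, hy, rfl⟩
      rw [hempty, Set.indicator_empty', map_zero, Pi.smul_apply, Set.indicator_of_notMem hx,
        smul_zero]
  change E (fun x => E' ((Prod.mk x ⁻¹' C).indicator 1)) = _
  rw [hinner, map_smul, hE _ _ hproj (hne.image _), smul_eq_mul, ← pow_add, add_comm,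
    finrank_map_fst_add_finrank_comap_inr]

theorem apply_indicator_eq_finsum {ι : Type*} {E : (V → ℚ) →ₗ[ℚ] ℚ} (hE : IsEulerFunctional E)
    {F : V → ι} {S : Set V} (hS : ∀ ⦃x y⦄, F x = F y → x ∈ S → y ∈ S) (hfin : (F '' S).Finite)
    {W : ι → Submodule ℝ V} (hF : ∀ i ∈ F '' S, IsRelOpenConvex (F ⁻¹' {i}) (W i)) :
    E (S.indicator 1) = ∑ᶠ i ∈ F '' S, (-1) ^ Module.finrank ℝ (W i) := by
  classical
  have hsum : S.indicator (1 : V → ℚ) = ∑ i ∈ hfin.toFinset, (F ⁻¹' {i}).indicator 1 := by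
    ext x
    have hx : x ∈ S ↔ F x ∈ F '' S :=
      ⟨Set.mem_image_of_mem F, fun ⟨y, hy, hyx⟩ => hS hyx hy⟩
    simp only [Set.indicator_apply, hx, Pi.one_apply, Finset.sum_apply, Set.mem_preimage,
      Set.mem_singleton_iff, Finset.sum_ite_eq, hfin.mem_toFinset]
  rw [hsum, map_sum, finsum_mem_eq_finite_toFinset_sum _ hfin]
  refine Finset.sum_congr rfl fun i hi => ?_
  obtain ⟨x, hx, rfl⟩ := hfin.mem_toFinset.1 hi
  exact hE _ _ (hF _ ⟨x, hx, rfl⟩) ⟨x, rfl⟩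

theorem apply_indicator_eq_ncard_mul {ι : Type*} {E : (V → ℚ) →ₗ[ℚ] ℚ} (hE : IsEulerFunctional E)
    {F : V → ι} {S : Set V} (hS : ∀ ⦃x y⦄, F x = F y → x ∈ S → y ∈ S) (hfin : (F '' S).Finite)
    {W : Submodule ℝ V} (hF : ∀ i ∈ F '' S, IsRelOpenConvex (F ⁻¹' {i}) W) :
    E (S.indicator 1) = (F '' S).ncard * (-1) ^ Module.finrank ℝ W := by
  rw [hE.apply_indicator_eq_finsum hS hfin hF, finsum_mem_eq_finite_toFinset_sum _ hfin,
    Finset.sum_const, nsmul_eq_mul, Set.ncard_eq_toFinset_card _ hfin]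

end IsEulerFunctional

theorem exists_isEulerFunctional (V : Type*) [AddCommGroup V] [Module ℝ V]
    [FiniteDimensional ℝ V] : ∃ E : (V → ℚ) →ₗ[ℚ] ℚ, IsEulerFunctional E := by
  have hpi (n : ℕ) : ∃ E : ((Fin n → ℝ) → ℚ) →ₗ[ℚ] ℚ, IsEulerFunctional E := by
    induction n with
    | zero =>
      refine ⟨LinearMap.proj 0, fun C W _ ⟨x, hx⟩ => ?_⟩
      have h0 : (0 : Fin 0 → ℝ) ∈ C := by rwa [Subsingleton.elim 0 x]
      rw [LinearMap.proj_apply, Set.indicator_of_mem h0, Module.finrank_zero_of_subsingleton,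
        pow_zero, Pi.one_apply]
    | succ n ih =>
      obtain ⟨E, hE⟩ := exists_isEulerFunctional_real
      obtain ⟨E', hE'⟩ := ih
      exact ⟨_, (hE.prod hE').comp_funLeft_equiv (Fin.consLinearEquiv ℝ fun _ => ℝ)⟩
  obtain ⟨E, hE⟩ := hpi (Module.finrank ℝ V)
  exact ⟨_, hE.comp_funLeft_equiv (Module.finBasis ℝ V).equivFun.symm⟩

theorem image_connectedComponentIn_of_dense {X : Type*} [TopologicalSpace X]
    [LocallyConnectedSpace X] {U D : Set X} (hU : IsOpen U) (hD : Dense D) (hDU : D ⊆ U) :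
    connectedComponentIn U '' D = connectedComponentIn U '' U := by
  refine (Set.image_mono hDU).antisymm ?_
  rintro - ⟨x, hx, rfl⟩
  obtain ⟨y, hyx, hyD⟩ := hD.inter_open_nonempty _ (hU.connectedComponentIn (x := x))
    ⟨x, mem_connectedComponentIn hx⟩
  exact ⟨y, hyD, (connectedComponentIn_eq hyx).symm⟩

theorem finite_image_and_ncard_image_le_of_factorsThrough {α β γ : Type*} {s : Set α} {f : α → β}
    {F : α → γ} (hfin : (F '' s).Finite) (hf : ∀ x ∈ s, ∀ y ∈ s, F x = F y → f x = f y) :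
    (f '' s).Finite ∧ (f '' s).ncard ≤ (F '' s).ncard := by
  rcases isEmpty_or_nonempty α with hα | hα
  · simp [Set.eq_empty_of_isEmpty s]
  have himage : (fun i => f (Function.invFunOn F s i)) '' (F '' s) = f '' s := by
    rw [Set.image_image]
    exact Set.image_congr fun x hx => hf _ (Function.invFunOn_apply_mem hx) x hx
      (Function.invFunOn_apply_eq hx)
  rw [← himage]
  exact ⟨hfin.image _, Set.ncard_image_le hfin⟩

theorem eventually_add_smul {E : Type*} [AddCommGroup E] [Module ℝ E] [TopologicalSpace E]
    [ContinuousAdd E] [ContinuousSMul ℝ E] {x : E} {p : E → Prop} (h : ∀ᶠ y in 𝓝 x, p y)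
    (w : E) : ∀ᶠ ε : ℝ in 𝓝[>] 0, p (x + ε • w) := by
  have hcont : Continuous fun ε : ℝ => x + ε • w := by fun_prop
  have hlim : Filter.Tendsto (fun ε : ℝ => x + ε • w) (𝓝 0) (𝓝 x) := by
    simpa using hcont.tendsto 0
  exact (hlim.mono_left nhdsWithin_le_nhds).eventually h

theorem isOpen_compl_nonlinearLocus {d : ℕ} (f : (Fin d → ℝ) → ℝ) :
    IsOpen (nonlinearLocus f)ᶜ := by
  refine isOpen_iff_eventually.2 fun x hx => ?_
  obtain ⟨l, hl⟩ := not_not.1 hx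
  exact hl.eventually_nhds.mono fun y hy => not_not.2 ⟨l, hy⟩

theorem linearRegions_eq_image_of_dense {d : ℕ} {f : (Fin d → ℝ) → ℝ} {D : Set (Fin d → ℝ)}
    (hD : Dense D) (hDf : D ⊆ (nonlinearLocus f)ᶜ) :
    linearRegions f = connectedComponentIn (nonlinearLocus f)ᶜ '' D := by
  rw [image_connectedComponentIn_of_dense (isOpen_compl_nonlinearLocus f) hD hDf]
  ext U
  exact exists_congr fun x => and_congr_right fun _ => eq_comm

theorem nonlinearLocus_sub_subset {d : ℕ} (f₁ f₂ : (Fin d → ℝ) → ℝ) :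
    nonlinearLocus (fun x => f₁ x - f₂ x) ⊆ nonlinearLocus f₁ ∪ nonlinearLocus f₂ := by
  intro x hx
  by_contra hx'
  obtain ⟨h₁, h₂⟩ := not_or.1 hx'
  obtain ⟨l₁, hl₁⟩ := not_not.1 h₁
  obtain ⟨l₂, hl₂⟩ := not_not.1 h₂
  refine hx ⟨l₁ - l₂, ?_⟩
  filter_upwards [hl₁, hl₂] with y hy₁ hy₂
  rw [hy₁, hy₂, AffineMap.coe_sub, Pi.sub_apply]

namespace TropicalSignomial

variable {d : ℕ} (g h : TropicalSignomial d)

theorem mem_argmax {x a : Fin d → ℝ} :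
    a ∈ g.argmax x ↔ a ∈ g.exponents ∧ g.monomial a x = g.eval x := by
  simp [argmax]

theorem monomial_le_eval {a : Fin d → ℝ} (ha : a ∈ g.exponents) (x : Fin d → ℝ) :
    g.monomial a x ≤ g.eval x :=
  Finset.le_sup' (fun a => g.monomial a x) ha

theorem argmax_nonempty (x : Fin d → ℝ) : (g.argmax x).Nonempty := by
  obtain ⟨a, ha, hmax⟩ :=
    Finset.exists_mem_eq_sup' g.exponents_nonempty fun a => g.monomial a x
  exact ⟨a, g.mem_argmax.2 ⟨ha, hmax.symm⟩⟩

theorem argmax_subset_exponents (x : Fin d → ℝ) : g.argmax x ⊆ g.exponents :=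
  Finset.filter_subset _ _

/-- The monomial with exponent `a`, as an affine map. -/
def monomialAffineMap (a : Fin d → ℝ) : (Fin d → ℝ) →ᵃ[ℝ] ℝ :=
  AffineMap.const ℝ _ (g.coeff a) + (dotProductBilin ℝ ℝ a).toAffineMap

theorem continuous_monomial (a : Fin d → ℝ) : Continuous (g.monomial a) :=
  (g.monomialAffineMap a).continuous_of_finiteDimensional

theorem continuous_eval : Continuous g.eval :=
  Continuous.finset_sup'_apply _ fun a _ => g.continuous_monomial a

theorem monomial_combo (a x y : Fin d → ℝ) {s t : ℝ} (hst : s + t = 1) :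
    g.monomial a (s • x + t • y) = s * g.monomial a x + t * g.monomial a y :=
  Convex.combo_affine_apply (f := g.monomialAffineMap a) hst

theorem monomial_add_smul (a x w : Fin d → ℝ) (t : ℝ) :
    g.monomial a (x + t • w) = g.monomial a x + t * (a ⬝ᵥ w) := by
  rw [monomial, dotProduct_add, dotProduct_smul, smul_eq_mul, ← add_assoc, ← monomial]

theorem eval_combo {x y c : Fin d → ℝ} (hx : c ∈ g.argmax x) (hy : c ∈ g.argmax y) {s t : ℝ}
    (hs : 0 ≤ s) (ht : 0 ≤ t) (hst : s + t = 1) :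
    g.eval (s • x + t • y) = s * g.eval x + t * g.eval y := by
  refine le_antisymm (Finset.sup'_le _ _ fun a ha => ?_) ?_
  · rw [g.monomial_combo _ _ _ hst]
    gcongr <;> exact g.monomial_le_eval ha _
  · rw [mem_argmax] at hx hy
    rw [← hx.2, ← hy.2, ← g.monomial_combo _ _ _ hst]
    exact g.monomial_le_eval hx.1 _

theorem mem_argmax_combo_iff {x y c : Fin d → ℝ} (hx : c ∈ g.argmax x) (hy : c ∈ g.argmax y)
    {s t : ℝ} (hs : 0 < s) (ht : 0 < t) (hst : s + t = 1) {a : Fin d → ℝ} :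
    a ∈ g.argmax (s • x + t • y) ↔ a ∈ g.argmax x ∧ a ∈ g.argmax y := by
  simp only [mem_argmax, g.eval_combo hx hy hs.le ht.le hst, g.monomial_combo _ _ _ hst]
  refine ⟨fun ⟨ha, hmax⟩ => ?_, fun ⟨⟨ha, hax⟩, _, hay⟩ => ⟨ha, by rw [hax, hay]⟩⟩
  have hlex := mul_le_mul_of_nonneg_left (g.monomial_le_eval ha x) hs.le
  have hley := mul_le_mul_of_nonneg_left (g.monomial_le_eval ha y) ht.le
  exact ⟨⟨ha, mul_left_cancel₀ hs.ne' (by linarith only [hlex, hley, hmax])⟩,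
    ha, mul_left_cancel₀ ht.ne' (by linarith only [hlex, hley, hmax])⟩

theorem eventually_argmax_subset (x : Fin d → ℝ) : ∀ᶠ y in 𝓝 x, g.argmax y ⊆ g.argmax x := by
  have hstrict : ∀ a ∈ g.exponents, a ∉ g.argmax x →
      ∀ᶠ y in 𝓝 x, g.monomial a y < g.eval y := fun a ha hax =>
    (g.continuous_monomial a).continuousAt.eventually_lt g.continuous_eval.continuousAt
      ((g.monomial_le_eval ha x).lt_of_ne fun hmax => hax (g.mem_argmax.2 ⟨ha, hmax⟩))
  have hall : ∀ᶠ y in 𝓝 x, ∀ a ∈ g.exponents, a ∉ g.argmax x → g.monomial a y < g.eval y :=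
    (Filter.eventually_all_finset _).2 fun a ha => by
      by_cases hax : a ∈ g.argmax x
      · exact Filter.Eventually.of_forall fun _ hax' => absurd hax hax'
      · exact (hstrict a ha hax).mono fun _ hy _ => hy
  filter_upwards [hall] with y hy a ha
  by_contra hax
  exact (hy a (g.argmax_subset_exponents y ha) hax).ne (g.mem_argmax.1 ha).2

/-- The directions along which all exponents in `A` have the same slope: the direction of the cell
on which the monomials with exponents in `A` attain the maximum. -/
def equalSlopes (A : Finset (Fin d → ℝ)) : Submodule ℝ (Fin d → ℝ) where
  carrier := {w | ∀ a ∈ A, ∀ b ∈ A, a ⬝ᵥ w = b ⬝ᵥ w}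
  add_mem' := fun hv hw a ha b hb => by
    rw [dotProduct_add, dotProduct_add, hv a ha b hb, hw a ha b hb]
  zero_mem' := fun a _ b _ => by rw [dotProduct_zero, dotProduct_zero]
  smul_mem' := fun c w hw a ha b hb => by rw [dotProduct_smul, dotProduct_smul, hw a ha b hb]

theorem equalSlopes_singleton (a : Fin d → ℝ) : equalSlopes {a} = ⊤ := by
  refine eq_top_iff.2 fun w _ b hb c hc => ?_
  rw [Finset.mem_singleton.1 hb, Finset.mem_singleton.1 hc]

theorem sub_mem_equalSlopes {A : Finset (Fin d → ℝ)} {x y : Fin d → ℝ} (hx : A ⊆ g.argmax x)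
    (hy : A ⊆ g.argmax y) : y - x ∈ equalSlopes A := by
  intro a ha b hb
  have hxab := (g.mem_argmax.1 (hx ha)).2.trans (g.mem_argmax.1 (hx hb)).2.symm
  have hyab := (g.mem_argmax.1 (hy ha)).2.trans (g.mem_argmax.1 (hy hb)).2.symm
  simp only [monomial] at hxab hyab
  rw [dotProduct_sub, dotProduct_sub]
  linarith

theorem argmax_add_smul_of_mem_equalSlopes {x w : Fin d → ℝ} {ε : ℝ}
    (hw : w ∈ equalSlopes (g.argmax x)) (hsub : g.argmax (x + ε • w) ⊆ g.argmax x) :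
    g.argmax (x + ε • w) = g.argmax x := by
  refine hsub.antisymm fun a ha => ?_
  obtain ⟨c, hc⟩ := g.argmax_nonempty (x + ε • w)
  have hmax : g.monomial a x = g.monomial c x :=
    (g.mem_argmax.1 ha).2.trans (g.mem_argmax.1 (hsub hc)).2.symm
  refine g.mem_argmax.2 ⟨g.argmax_subset_exponents x ha, ?_⟩
  rw [← (g.mem_argmax.1 hc).2, monomial_add_smul, monomial_add_smul, hmax, hw a ha c (hsub hc)]

theorem isRelOpenConvex_argmax_preimage (A : Finset (Fin d → ℝ)) :
    IsRelOpenConvex (g.argmax ⁻¹' {A}) (equalSlopes A) := by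
  refine ⟨convex_iff_forall_pos.2 ?_, ?_⟩
  · rintro x rfl y (hy : g.argmax y = g.argmax x) s t hs ht hst
    obtain ⟨c, hc⟩ := g.argmax_nonempty x
    ext a
    rw [g.mem_argmax_combo_iff hc (hy ▸ hc) hs ht hst, hy, and_self]
  · rintro x rfl w
    refine ⟨fun hw => ?_, ?_⟩
    · obtain ⟨ε, hsub, hε⟩ := ((eventually_add_smul (g.eventually_argmax_subset x) w).and
        self_mem_nhdsWithin).exists
      exact ⟨ε, hε, g.argmax_add_smul_of_mem_equalSlopes hw hsub⟩
    · rintro ⟨ε, hε, hmax⟩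
      have hmem := g.sub_mem_equalSlopes subset_rfl (ge_of_eq hmax)
      rw [add_sub_cancel_left] at hmem
      exact (Submodule.smul_mem_iff _ hε.ne').1 hmem

theorem exists_argmax_eq_singleton_of_notMem_nonlinearLocus {x : Fin d → ℝ}
    (hx : x ∉ nonlinearLocus g.eval) : ∃ a, g.argmax x = {a} := by
  obtain ⟨l, hl⟩ := not_not.1 hx
  have hle : ∀ a ∈ g.argmax x, ∀ w, a ⬝ᵥ w ≤ l.linear w := by
    intro a ha w
    obtain ⟨ε, heval, hε⟩ := ((eventually_add_smul hl w).and self_mem_nhdsWithin).exists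
    have hmax := g.monomial_le_eval (g.argmax_subset_exponents x ha) (x + ε • w)
    have hlw : l (x + ε • w) = ε * l.linear w + l x := by
      rw [add_comm, ← vadd_eq_add, l.map_vadd, map_smul, smul_eq_mul, vadd_eq_add]
    rw [heval, hlw, monomial_add_smul, (g.mem_argmax.1 ha).2, hl.self_of_nhds] at hmax
    exact le_of_mul_le_mul_left (by linarith) hε
  have heq : ∀ a ∈ g.argmax x, ∀ w, a ⬝ᵥ w = l.linear w := by
    intro a ha w
    have hneg := hle a ha (-w)
    rw [dotProduct_neg, map_neg] at hneg
    exact (hle a ha w).antisymm (neg_le_neg_iff.1 hneg)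
  obtain ⟨a, ha⟩ := g.argmax_nonempty x
  exact ⟨a, Finset.eq_singleton_iff_unique_mem.2
    ⟨ha, fun b hb => dotProduct_eq _ _ fun w => (heq b hb w).trans (heq a ha w).symm⟩⟩

theorem notMem_nonlinearLocus_eval_iff {x : Fin d → ℝ} :
    x ∉ nonlinearLocus g.eval ↔ ∃ a, g.argmax x = {a} := by
  refine ⟨g.exists_argmax_eq_singleton_of_notMem_nonlinearLocus, ?_⟩
  rintro ⟨a, ha⟩
  refine not_not.2 ⟨g.monomialAffineMap a, ?_⟩
  filter_upwards [g.eventually_argmax_subset x] with y hy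
  obtain ⟨c, hc⟩ := g.argmax_nonempty y
  obtain rfl : c = a := by simpa [ha] using hy hc
  exact (g.mem_argmax.1 hc).2.symm

theorem mem_nonlinearLocus_eval_congr {x y : Fin d → ℝ} (hxy : g.argmax x = g.argmax y) :
    x ∈ nonlinearLocus g.eval ↔ y ∈ nonlinearLocus g.eval := by
  rw [← not_iff_not, notMem_nonlinearLocus_eval_iff, notMem_nonlinearLocus_eval_iff, hxy]

theorem mem_nonlinearLocus_eval_of_argmax_subset {x y : Fin d → ℝ}
    (hx : x ∈ nonlinearLocus g.eval) (hxy : g.argmax x ⊆ g.argmax y) :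
    y ∈ nonlinearLocus g.eval := by
  contrapose! hx
  obtain ⟨a, ha⟩ := g.notMem_nonlinearLocus_eval_iff.1 hx
  exact g.notMem_nonlinearLocus_eval_iff.2
    ⟨a, (g.argmax_nonempty x).subset_singleton_iff.1 (ha ▸ hxy)⟩

theorem eventually_argmax_add_smul_ssubset {x a b : Fin d → ℝ} (ha : a ∈ g.argmax x)
    (hb : b ∈ g.argmax x) (hab : a ≠ b) :
    ∀ᶠ ε : ℝ in 𝓝[>] 0, g.argmax (x + ε • (a - b)) ⊂ g.argmax x := by
  have hpos : 0 < (a - b) ⬝ᵥ (a - b) := by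
    simpa using Matrix.dotProduct_star_self_pos_iff.2 (sub_ne_zero.2 hab)
  filter_upwards [eventually_add_smul (g.eventually_argmax_subset x) (a - b), self_mem_nhdsWithin]
    with ε hsub hε
  refine (Finset.ssubset_iff_of_subset hsub).2 ⟨b, hb, fun hb' => ?_⟩
  have hle := g.monomial_le_eval (g.mem_argmax.1 ha).1 (x + ε • (a - b))
  rw [← (g.mem_argmax.1 hb').2, monomial_add_smul, monomial_add_smul, (g.mem_argmax.1 ha).2,
    (g.mem_argmax.1 hb).2, add_le_add_iff_left, mul_le_mul_iff_right₀ hε] at hle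
  rw [sub_dotProduct] at hpos
  linarith

theorem dense_compl_nonlinearLocus_eval : Dense (nonlinearLocus g.eval)ᶜ := by
  refine dense_iff_inter_open.2 fun U hU hne => ?_
  obtain ⟨x, hxU, hmin⟩ := exists_minimalFor_of_wellFoundedLT (· ∈ U) g.argmax hne
  refine ⟨x, hxU, g.notMem_nonlinearLocus_eval_iff.2 ?_⟩
  obtain ⟨a, ha⟩ := g.argmax_nonempty x
  refine ⟨a, Finset.eq_singleton_iff_unique_mem.2 ⟨ha, fun b hb => ?_⟩⟩
  by_contra hba
  obtain ⟨ε, hlt, hεU⟩ := ((g.eventually_argmax_add_smul_ssubset ha hb (Ne.symm hba)).and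
    (eventually_add_smul (hU.mem_nhds hxU) (a - b))).exists
  exact hlt.not_subset (hmin hεU hlt.subset)

theorem not_redundant_iff {a : Fin d → ℝ} : ¬g.Redundant a ↔ ∃ x, g.argmax x = {a} := by
  constructor
  · intro hred
    by_cases hne : (g.exponents.erase a).Nonempty
    · obtain ⟨x, hx⟩ := not_forall.1 fun heq => hred ⟨hne, heq⟩
      refine ⟨x, (g.argmax_nonempty x).subset_singleton_iff.1 fun b hb => ?_⟩
      by_contra hba
      refine hx (le_antisymm (Finset.sup'_le _ _ fun c hc =>
        g.monomial_le_eval (Finset.mem_of_mem_erase hc) x) ?_)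
      rw [← (g.mem_argmax.1 hb).2]
      exact Finset.le_sup' (fun b => g.monomial b x) (Finset.mem_erase.2
        ⟨Finset.notMem_singleton.1 hba, (g.mem_argmax.1 hb).1⟩)
    · refine ⟨0, (g.argmax_nonempty 0).subset_singleton_iff.1 fun b hb => ?_⟩
      by_contra hba
      exact hne ⟨b, Finset.mem_erase.2
        ⟨Finset.notMem_singleton.1 hba, g.argmax_subset_exponents 0 hb⟩⟩
  · rintro ⟨x, hx⟩ ⟨hne, heq⟩
    obtain ⟨b, hb, hbx⟩ := Finset.exists_mem_eq_sup' hne fun b => g.monomial b x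
    have hmem : b ∈ g.argmax x :=
      g.mem_argmax.2 ⟨Finset.mem_of_mem_erase hb, hbx.symm.trans (heq x)⟩
    rw [hx, Finset.mem_singleton] at hmem
    exact Finset.ne_of_mem_erase hb hmem

theorem mlen_eq_ncard_image_argmax :
    g.mlen = (g.argmax '' (nonlinearLocus g.eval)ᶜ).ncard := by
  classical
  have himage : g.argmax '' (nonlinearLocus g.eval)ᶜ =
      singleton '' (g.exponents.filter fun a => ¬g.Redundant a : Set (Fin d → ℝ)) := by
    ext A
    constructor
    · rintro ⟨x, hx, rfl⟩
      obtain ⟨a, ha⟩ := g.notMem_nonlinearLocus_eval_iff.1 hx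
      have hmem : a ∈ g.exponents :=
        g.argmax_subset_exponents x (ha ▸ Finset.mem_singleton_self a)
      exact ⟨a, Finset.mem_coe.2 (Finset.mem_filter.2 ⟨hmem, g.not_redundant_iff.2 ⟨x, ha⟩⟩),
        ha.symm⟩
    · rintro ⟨a, ha, rfl⟩
      obtain ⟨x, hx⟩ := g.not_redundant_iff.1 (Finset.mem_filter.1 ha).2
      exact ⟨x, g.notMem_nonlinearLocus_eval_iff.2 ⟨a, hx⟩, hx⟩
  rw [himage, Set.ncard_image_of_injective _ Finset.singleton_injective, Set.ncard_coe_finset, mlen]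

theorem finite_range_argmax : (Set.range g.argmax).Finite := by
  refine g.exponents.powerset.finite_toSet.subset ?_
  rintro - ⟨x, rfl⟩
  exact Finset.mem_coe.2 (Finset.mem_powerset.2 (g.argmax_subset_exponents x))

theorem equalSlopes_argmax_eq_top {x : Fin d → ℝ} (hx : x ∉ nonlinearLocus g.eval) :
    equalSlopes (g.argmax x) = ⊤ := by
  obtain ⟨a, ha⟩ := g.notMem_nonlinearLocus_eval_iff.1 hx
  rw [ha, equalSlopes_singleton]

/-- The exponents of `g` and of `h` that attain the maximum at `x`. The fibres of this map are the
relatively open cells of the common refinement of the subdivisions induced by `g` and `h`. -/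
noncomputable def jointArgmax (x : Fin d → ℝ) : Finset (Fin d → ℝ) × Finset (Fin d → ℝ) :=
  (g.argmax x, h.argmax x)

/-- The closed cell of the common refinement of the subdivisions induced by `g` and `h` on which
the exponents in `p.1` and `p.2` attain the maximum. -/
def jointCell (p : Finset (Fin d → ℝ) × Finset (Fin d → ℝ)) : Set (Fin d → ℝ) :=
  {y | p ≤ g.jointArgmax h y}

variable {g h} in
theorem mem_nonlinearLocus_congr_of_jointArgmax_eq {x y : Fin d → ℝ}
    (hxy : g.jointArgmax h x = g.jointArgmax h y) :
    (x ∈ nonlinearLocus g.eval ↔ y ∈ nonlinearLocus g.eval) ∧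
      (x ∈ nonlinearLocus h.eval ↔ y ∈ nonlinearLocus h.eval) :=
  ⟨g.mem_nonlinearLocus_eval_congr (congrArg Prod.fst hxy),
    h.mem_nonlinearLocus_eval_congr (congrArg Prod.snd hxy)⟩

theorem mem_jointCell_jointArgmax (x : Fin d → ℝ) : x ∈ g.jointCell h (g.jointArgmax h x) :=
  le_refl (g.jointArgmax h x)

theorem jointCell_antitone : Antitone (g.jointCell h) := fun _ _ hpq _ hy =>
  le_trans hpq hy

theorem finite_range_jointArgmax : (Set.range (g.jointArgmax h)).Finite := by
  refine (g.finite_range_argmax.prod h.finite_range_argmax).subset ?_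
  rintro - ⟨x, rfl⟩
  exact ⟨⟨x, rfl⟩, x, rfl⟩

theorem isRelOpenConvex_jointArgmax_preimage (p : Finset (Fin d → ℝ) × Finset (Fin d → ℝ)) :
    IsRelOpenConvex (g.jointArgmax h ⁻¹' {p}) (equalSlopes p.1 ⊓ equalSlopes p.2) := by
  have hfibre : g.jointArgmax h ⁻¹' {p} = g.argmax ⁻¹' {p.1} ∩ h.argmax ⁻¹' {p.2} :=
    Set.ext fun _ => Prod.ext_iff
  rw [hfibre]
  exact (g.isRelOpenConvex_argmax_preimage p.1).inter (h.isRelOpenConvex_argmax_preimage p.2)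

theorem cellDim_jointCell_jointArgmax (x : Fin d → ℝ) :
    cellDim (g.jointCell h (g.jointArgmax h x)) = Module.finrank ℝ
      (equalSlopes (g.argmax x) ⊓ equalSlopes (h.argmax x) : Submodule ℝ (Fin d → ℝ)) := by
  suffices hspan : vectorSpan ℝ (g.jointCell h (g.jointArgmax h x)) =
      equalSlopes (g.argmax x) ⊓ equalSlopes (h.argmax x) by
    rw [cellDim, hspan]
  refine le_antisymm (Submodule.span_le.2 ?_) ?_
  · rintro - ⟨y, hy, z, hz, rfl⟩
    exact ⟨g.sub_mem_equalSlopes hz.1 hy.1, h.sub_mem_equalSlopes hz.2 hy.2⟩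
  · refine ((g.isRelOpenConvex_jointArgmax_preimage h _).le_vectorSpan ⟨x, rfl⟩).trans
      (vectorSpan_mono ℝ ?_)
    exact fun y hy => ge_of_eq hy

theorem jointCell_injOn : Set.InjOn (g.jointCell h) (Set.range (g.jointArgmax h)) := by
  have hle {x y : Fin d → ℝ} (heq : g.jointCell h (g.jointArgmax h x) =
      g.jointCell h (g.jointArgmax h y)) : g.jointArgmax h y ≤ g.jointArgmax h x :=
    heq.subset (g.mem_jointCell_jointArgmax h x)
  rintro - ⟨x, rfl⟩ - ⟨y, rfl⟩ heq
  exact (hle heq.symm).antisymm (hle heq)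

theorem exists_jointArgmax_between {p : Finset (Fin d → ℝ) × Finset (Fin d → ℝ)}
    (hp₁ : p.1.Nonempty) (hp₂ : p.2.Nonempty) {x y : Fin d → ℝ} (hx : x ∈ g.jointCell h p)
    (hy : y ∈ g.jointCell h p) : ∃ m ∈ g.jointCell h p,
      g.jointArgmax h m ≤ g.jointArgmax h x ∧ g.jointArgmax h m ≤ g.jointArgmax h y := by
  obtain ⟨a, ha⟩ := hp₁
  obtain ⟨b, hb⟩ := hp₂
  have hg (c : Fin d → ℝ) :=
    g.mem_argmax_combo_iff (hx.1 ha) (hy.1 ha) one_half_pos one_half_pos (add_halves 1) (a := c)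
  have hh (c : Fin d → ℝ) :=
    h.mem_argmax_combo_iff (hx.2 hb) (hy.2 hb) one_half_pos one_half_pos (add_halves 1) (a := c)
  exact ⟨(1 / 2 : ℝ) • x + (1 / 2 : ℝ) • y,
    ⟨fun c hc => (hg c).2 ⟨hx.1 hc, hy.1 hc⟩, fun c hc => (hh c).2 ⟨hx.2 hc, hy.2 hc⟩⟩,
    ⟨fun c hc => ((hg c).1 hc).1, fun c hc => ((hh c).1 hc).1⟩,
    ⟨fun c hc => ((hg c).1 hc).2, fun c hc => ((hh c).1 hc).2⟩⟩

theorem exists_jointCell_jointArgmax_eq {p : Finset (Fin d → ℝ) × Finset (Fin d → ℝ)}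
    (hp₁ : p.1.Nonempty) (hp₂ : p.2.Nonempty) (hne : (g.jointCell h p).Nonempty) :
    ∃ x ∈ g.jointCell h p, g.jointCell h (g.jointArgmax h x) = g.jointCell h p := by
  obtain ⟨x, hx, hmin⟩ :=
    exists_minimalFor_of_wellFoundedLT (· ∈ g.jointCell h p) (g.jointArgmax h) hne
  refine ⟨x, hx, (g.jointCell_antitone h hx).antisymm fun y hy => ?_⟩
  obtain ⟨m, hm, hmx, hmy⟩ := g.exists_jointArgmax_between h hp₁ hp₂ hx hy
  exact (hmin hm hmx).trans hmy

theorem complexInter_hypersurface_eq_image : complexInter g.hypersurface h.hypersurface =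
    g.jointCell h '' (g.jointArgmax h '' (nonlinearLocus g.eval ∩ nonlinearLocus h.eval)) := by
  ext R
  constructor
  · rintro ⟨hne, -, ⟨u, hu, rfl⟩, -, ⟨v, hv, rfl⟩, rfl⟩
    obtain ⟨x, hx, hcell⟩ := g.exists_jointCell_jointArgmax_eq h
      (p := (g.argmax u, h.argmax v)) (g.argmax_nonempty u) (h.argmax_nonempty v) hne
    exact ⟨_, ⟨x, ⟨g.mem_nonlinearLocus_eval_of_argmax_subset hu hx.1,
      h.mem_nonlinearLocus_eval_of_argmax_subset hv hx.2⟩, rfl⟩, hcell⟩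
  · rintro ⟨-, ⟨x, hx, rfl⟩, rfl⟩
    exact ⟨⟨x, g.mem_jointCell_jointArgmax h x⟩, _, ⟨x, hx.1, rfl⟩, _, ⟨x, hx.2, rfl⟩, rfl⟩

theorem eulerChar_complexInter_hypersurface :
    eulerChar (complexInter g.hypersurface h.hypersurface) =
      ∑ᶠ p ∈ g.jointArgmax h '' (nonlinearLocus g.eval ∩ nonlinearLocus h.eval),
        (-1) ^ Module.finrank ℝ (equalSlopes p.1 ⊓ equalSlopes p.2 : Submodule ℝ (Fin d → ℝ)) := by
  rw [eulerChar, complexInter_hypersurface_eq_image,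
    finsum_mem_image ((g.jointCell_injOn h).mono (Set.image_subset_range _ _))]
  refine finsum_mem_congr rfl ?_
  rintro - ⟨x, -, rfl⟩
  rw [cellDim_jointCell_jointArgmax, jointArgmax]

variable {E : ((Fin d → ℝ) → ℚ) →ₗ[ℚ] ℚ}

theorem apply_indicator_nonlinearLocus_inter (hE : IsEulerFunctional E) :
    E ((nonlinearLocus g.eval ∩ nonlinearLocus h.eval).indicator 1) =
      eulerChar (complexInter g.hypersurface h.hypersurface) := by
  have hfin := (g.finite_range_jointArgmax h).subset
    (Set.image_subset_range _ (nonlinearLocus g.eval ∩ nonlinearLocus h.eval))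
  rw [eulerChar_complexInter_hypersurface, hE.apply_indicator_eq_finsum ?_ hfin fun p _ =>
    g.isRelOpenConvex_jointArgmax_preimage h p]
  · have hcast := (Int.castAddHom ℚ).map_finsum_mem (fun p => (-1) ^ Module.finrank ℝ
      (equalSlopes p.1 ⊓ equalSlopes p.2 : Submodule ℝ (Fin d → ℝ))) hfin
    simpa using hcast.symm
  · intro x y hxy hx
    obtain ⟨hg, hh⟩ := mem_nonlinearLocus_congr_of_jointArgmax_eq hxy
    exact ⟨hg.1 hx.1, hh.1 hx.2⟩

theorem apply_indicator_compl_nonlinearLocus (hE : IsEulerFunctional E) :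
    E ((nonlinearLocus g.eval)ᶜ.indicator 1) = g.mlen * (-1) ^ d := by
  have hdir : ∀ A ∈ g.argmax '' (nonlinearLocus g.eval)ᶜ, equalSlopes A = ⊤ := by
    rintro - ⟨x, hx, rfl⟩
    exact g.equalSlopes_argmax_eq_top hx
  rw [hE.apply_indicator_eq_ncard_mul ?_
    (g.finite_range_argmax.subset (Set.image_subset_range _ _))
    fun A hA => hdir A hA ▸ g.isRelOpenConvex_argmax_preimage A, finrank_top,
    Module.finrank_fin_fun, mlen_eq_ncard_image_argmax]
  exact fun x y hxy => mt (g.mem_nonlinearLocus_eval_congr hxy).2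

theorem apply_indicator_compl_nonlinearLocus_inter_compl (hE : IsEulerFunctional E) :
    E (((nonlinearLocus g.eval)ᶜ ∩ (nonlinearLocus h.eval)ᶜ).indicator 1) =
      (g.jointArgmax h '' ((nonlinearLocus g.eval)ᶜ ∩ (nonlinearLocus h.eval)ᶜ)).ncard *
        (-1) ^ d := by
  have hdir : ∀ p ∈ g.jointArgmax h '' ((nonlinearLocus g.eval)ᶜ ∩ (nonlinearLocus h.eval)ᶜ),
      equalSlopes p.1 ⊓ equalSlopes p.2 = ⊤ := by
    rintro - ⟨x, hx, rfl⟩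
    exact inf_eq_top_iff.2 ⟨g.equalSlopes_argmax_eq_top hx.1, h.equalSlopes_argmax_eq_top hx.2⟩
  rw [hE.apply_indicator_eq_ncard_mul ?_
    ((g.finite_range_jointArgmax h).subset (Set.image_subset_range _ _))
    fun p hp => hdir p hp ▸ g.isRelOpenConvex_jointArgmax_preimage h p, finrank_top,
    Module.finrank_fin_fun]
  intro x y hxy hx
  obtain ⟨hg, hh⟩ := mem_nonlinearLocus_congr_of_jointArgmax_eq hxy
  exact ⟨mt hg.2 hx.1, mt hh.2 hx.2⟩

theorem ncard_image_jointArgmax_add_one :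
    ((g.jointArgmax h '' ((nonlinearLocus g.eval)ᶜ ∩ (nonlinearLocus h.eval)ᶜ)).ncard : ℤ) + 1 =
      g.mlen + h.mlen + (-1) ^ d * eulerChar (complexInter g.hypersurface h.hypersurface) := by
  obtain ⟨E, hE⟩ := exists_isEulerFunctional (Fin d → ℝ)
  have hone : E 1 = (-1) ^ d := by
    rw [← Set.indicator_univ 1, hE _ _ IsRelOpenConvex.univ Set.univ_nonempty, finrank_top,
      Module.finrank_fin_fun]
  have hsplit := congrArg E (Set.indicator_self_add_compl
    (nonlinearLocus g.eval ∩ nonlinearLocus h.eval) 1)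
  have hincl := congrArg E (Set.indicator_union_add_inter 1
    (nonlinearLocus g.eval)ᶜ (nonlinearLocus h.eval)ᶜ)
  rw [hone, map_add, g.apply_indicator_nonlinearLocus_inter h hE,
    Set.compl_inter] at hsplit
  rw [map_add, map_add, g.apply_indicator_compl_nonlinearLocus hE,
    h.apply_indicator_compl_nonlinearLocus hE,
    g.apply_indicator_compl_nonlinearLocus_inter_compl h hE] at hincl
  have hsq : (-1 : ℚ) ^ d * (-1) ^ d = 1 := by rw [← mul_pow, neg_one_mul, neg_neg, one_pow]
  qify
  linear_combination (-1) ^ d * (hincl - hsplit) -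
    ((g.jointArgmax h '' ((nonlinearLocus g.eval)ᶜ ∩ (nonlinearLocus h.eval)ᶜ)).ncard + 1 -
      g.mlen - h.mlen) * hsq

variable {g h} in
theorem connectedComponentIn_eq_of_jointArgmax_eq {U : Set (Fin d → ℝ)}
    (hU : (nonlinearLocus g.eval)ᶜ ∩ (nonlinearLocus h.eval)ᶜ ⊆ U) {x y : Fin d → ℝ}
    (hx : x ∈ (nonlinearLocus g.eval)ᶜ ∩ (nonlinearLocus h.eval)ᶜ)
    (hxy : g.jointArgmax h x = g.jointArgmax h y) :
    connectedComponentIn U x = connectedComponentIn U y := by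
  have hfibre : g.jointArgmax h ⁻¹' {g.jointArgmax h x} ⊆ U := fun z hz => by
    obtain ⟨hg, hh⟩ := mem_nonlinearLocus_congr_of_jointArgmax_eq hz
    exact hU ⟨mt hg.1 hx.1, mt hh.1 hx.2⟩
  exact connectedComponentIn_eq
    ((g.isRelOpenConvex_jointArgmax_preimage h _).convex.isPreconnected.subset_connectedComponentIn
      rfl hfibre hxy.symm)

end TropicalSignomial

theorem mainTheorem11_general {d : ℕ} (g h : TropicalSignomial d) {φ : (Fin d → ℝ) → ℝ}
    (hφ : nonlinearLocus φ ⊆ nonlinearLocus g.eval ∪ nonlinearLocus h.eval) :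
    (linearRegions φ).Finite ∧
      ((linearRegions φ).ncard : ℤ) + 1 ≤ g.mlen + h.mlen +
        (-1) ^ d * eulerChar (complexInter g.hypersurface h.hypersurface) := by
  set D := (nonlinearLocus g.eval)ᶜ ∩ (nonlinearLocus h.eval)ᶜ with hD
  have hDφ : D ⊆ (nonlinearLocus φ)ᶜ := by
    rw [hD, ← Set.compl_union]
    exact Set.compl_subset_compl.2 hφ
  have hdense : Dense D := g.dense_compl_nonlinearLocus_eval.inter_of_isOpen_left
    h.dense_compl_nonlinearLocus_eval (isOpen_compl_nonlinearLocus _)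
  obtain ⟨hfin, hle⟩ := finite_image_and_ncard_image_le_of_factorsThrough
    ((g.finite_range_jointArgmax h).subset (Set.image_subset_range _ D)) fun x hx y _ =>
      TropicalSignomial.connectedComponentIn_eq_of_jointArgmax_eq hDφ hx (y := y)
  rw [← linearRegions_eq_image_of_dense hdense hDφ] at hfin hle
  rw [← g.ncard_image_jointArgmax_add_one h]
  exact ⟨hfin, by gcongr⟩

theorem mainTheorem11 (d : ℕ) (g h : TropicalSignomial d) (φ : (Fin d → ℝ) → ℝ)
    (hφ : ∀ x, φ x = g.eval x - h.eval x) :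
    (linearRegions φ).Finite ∧
      ((linearRegions φ).ncard : ℤ) ≤
        (g.mlen : ℤ) + (h.mlen : ℤ) +
          (-1 : ℤ) ^ (d + 2) * eulerChar (complexInter g.hypersurface h.hypersurface) := by
  obtain ⟨hfin, hle⟩ := mainTheorem11_general g h (funext hφ ▸ nonlinearLocus_sub_subset _ _)
  exact ⟨hfin, by rw [pow_add, neg_one_sq, mul_one]; linarith⟩
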